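/- Let $k$ be a field. A (right-right) entwining structure $(A,C,\psi)$ over $k$ consists of an associative unital $k$-algebra $A$, a coassociative counital $k$-coalgebra $C$ with comultiplication $\Delta(c)=c_{(1)}\otimes c_{(2)}$ and counit $\varepsilon$, and a $k$-linear map $\psi: C\otimes A\to A\otimes C$, written $\psi(c\otimes a)=a_\psi\otimes c^\psi=a_\Psi\otimes c^\Psi$ (summation understood), such that for all $a,b\in A$, $c\in C$: $$(ab)_\psi\otimes c^\psi=a_\psi b_\Psi\otimes c^{\psi\Psi},\qquad (1_A)_\psi\otimes c^\psi=1_A\otimes c,$$ $$a_\psi\otimes\Delta(c^\psi)=a_{\psi\Psi}\otimes c_{(1)}^{\Psi}\otimes c_{(2)}^{\psi},\qquad \varepsilon(c^\psi)a_\psi=\varepsilon(c)a.$$ An entwined module is a $k$-vector space $M$ which is both a right $A$-module and a right $C$-comodule, with coaction $\rho(m)=m_{[0]}\otimes m_{[1]}$, such that $\rho(ma)=m_{[0]}a_\psi\otimes m_{[1]}^\psi$ for all $m\in M$, $a\in A$. Entwined modules and the $A$-linear $C$-colinear maps form the category $\mathcal{M}(\psi)_A^C$. For a $k$-vector space $V$,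 the space $\mathrm{Hom}_k(A,V)$ is a right $A$-module by $(f\cdot a)(b)=f(ab)$, and $\mathrm{Hom}_k(A,V)\otimes C$ is an entwined module with action $(f\otimes c)a=f\cdot a_\psi\otimes c^\psi$ and coaction $f\otimes c\mapsto f\otimes c_{(1)}\otimes c_{(2)}$. Let $(A,C,\psi)$ be an entwining structure over a field $k$, and let $Q$ be an object of $\mathcal{M}(\psi)_A^C$. Then $Q$ is an injective object of $\mathcal{M}(\psi)_A^C$ if and only if there exists a $k$-vector space $V$ such that $Q$ is isomorphic, in $\mathcal{M}(\psi)_A^C$, to a direct summand of $\mathrm{Hom}_k(A,V)\otimes C$. -/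

import Mathlib

open scoped TensorProduct
open CategoryTheory

universe uk uA uC w

/-- A right-right entwining structure `(A, C, ψ)`: a `k`-algebra `A`, a `k`-coalgebra `C` and a
`k`-linear map `ψ : C ⊗ A → A ⊗ C`, written `ψ(c ⊗ a) = a_ψ ⊗ c^ψ`, satisfying the four axioms. -/
structure EntwiningStructure (k : Type uk) (A : Type uA) (C : Type uC) [CommRing k]
    [Ring A] [Algebra k A] [AddCommGroup C] [Module k C] [Coalgebra k C] where
  /-- the entwining map -/
  ψ : C ⊗[k] A →ₗ[k] A ⊗[k] C
  /-- `(ab)_ψ ⊗ c^ψ = a_ψ b_Ψ ⊗ c^{ψΨ}` -/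
  map_mul : ∀ (c : C) (a b : A),
    ψ (c ⊗ₜ (a * b)) =
      (LinearMap.mul' k A).rTensor C ((TensorProduct.assoc k A A C).symm
        (ψ.lTensor A (TensorProduct.assoc k A C A (ψ (c ⊗ₜ a) ⊗ₜ b))))
  /-- `1_ψ ⊗ c^ψ = 1 ⊗ c` -/
  map_one : ∀ c : C, ψ (c ⊗ₜ 1) = 1 ⊗ₜ c
  /-- `a_ψ ⊗ Δ(c^ψ) = a_{ψΨ} ⊗ c₍₁₎^Ψ ⊗ c₍₂₎^ψ` -/
  map_comul : ∀ (c : C) (a : A),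
    (Coalgebra.comul (R := k) (A := C)).lTensor A (ψ (c ⊗ₜ a)) =
      TensorProduct.assoc k A C C (ψ.rTensor C ((TensorProduct.assoc k C A C).symm
        (ψ.lTensor C (TensorProduct.assoc k C C A (Coalgebra.comul (R := k) c ⊗ₜ a)))))
  /-- `ε(c^ψ) a_ψ = ε(c) a` -/
  map_counit : ∀ (c : C) (a : A),
    TensorProduct.rid k A ((Coalgebra.counit (R := k) (A := C)).lTensor A (ψ (c ⊗ₜ a))) =
      Coalgebra.counit (R := k) c • a

section

variable {k : Type uk} {A : Type uA} {C : Type uC} [CommRing k]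
    [Ring A] [Algebra k A] [AddCommGroup C] [Module k C] [Coalgebra k C]

/-- For a `k`-bilinear map `M × A → M`, `(m, a) ↦ m a`, the induced map on `M ⊗ C`:
`(m ⊗ c) a = m a_ψ ⊗ c^ψ`. -/
noncomputable def EntwiningStructure.tensorAct (E : EntwiningStructure k A C)
    {M : Type w} [AddCommGroup M] [Module k M] (act : M →ₗ[k] A →ₗ[k] M) :
    M ⊗[k] C →ₗ[k] A →ₗ[k] M ⊗[k] C :=
  TensorProduct.curry
    ((TensorProduct.lift act).rTensor C ∘ₗ (TensorProduct.assoc k M A C).symm.toLinearMap ∘ₗ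
      E.ψ.lTensor M ∘ₗ (TensorProduct.assoc k M C A).toLinearMap)

/-- An entwined module: a `k`-module with a right `A`-action and a right `C`-coaction `ρ` such
that `ρ(m a) = m₍₀₎ a_ψ ⊗ m₍₁₎^ψ`. -/
structure EntwinedModule (E : EntwiningStructure k A C) where
  /-- the underlying `k`-module -/
  carrier : Type w
  [addCommGroup : AddCommGroup carrier]
  [module : Module k carrier]
  /-- the right action `(m, a) ↦ m a` -/
  act : carrier →ₗ[k] A →ₗ[k] carrier
  /-- the right coaction -/
  coact : carrier →ₗ[k] carrier ⊗[k] C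
  act_one : ∀ m, act m 1 = m
  act_mul : ∀ m a b, act m (a * b) = act (act m a) b
  coact_coassoc : ∀ m,
    TensorProduct.assoc k carrier C C (coact.rTensor C (coact m)) =
      (Coalgebra.comul (R := k) (A := C)).lTensor carrier (coact m)
  coact_counit : ∀ m,
    TensorProduct.rid k carrier
      ((Coalgebra.counit (R := k) (A := C)).lTensor carrier (coact m)) = m
  coact_act : ∀ m a, coact (act m a) = E.tensorAct act (coact m) a

attribute [instance] EntwinedModule.addCommGroup EntwinedModule.module

namespace EntwinedModule

variable {E : EntwiningStructure k A C}

/-- Morphisms of entwined modules: `A`-linear and `C`-colinear (`k`-linear) maps. -/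
@[ext]
structure Hom (M N : EntwinedModule.{uk, uA, uC, w} E) where
  /-- the underlying `k`-linear map -/
  toLinearMap : M.carrier →ₗ[k] N.carrier
  map_act : ∀ m a, toLinearMap (M.act m a) = N.act (toLinearMap m) a
  map_coact : ∀ m, N.coact (toLinearMap m) = toLinearMap.rTensor C (M.coact m)

/-- The category of entwined modules. -/
instance : Category.{w} (EntwinedModule.{uk, uA, uC, w} E) where
  Hom M N := Hom M N
  id M := ⟨LinearMap.id, fun _ _ => rfl, fun m => by simp⟩
  comp f g := ⟨g.toLinearMap ∘ₗ f.toLinearMap,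
    fun m a => by simp [f.map_act, g.map_act],
    fun m => by simp [f.map_coact, g.map_coact, LinearMap.rTensor_comp]⟩

end EntwinedModule

namespace EntwiningStructure

variable (E : EntwiningStructure k A C)

section tensor

variable {M : Type w} [AddCommGroup M] [Module k M] (act : M →ₗ[k] A →ₗ[k] M)

theorem tensorAct_tmul (m : M) (c : C) (a : A) :
    E.tensorAct act (m ⊗ₜ c) a = (act m).rTensor C (E.ψ (c ⊗ₜ a)) := by
  simp only [tensorAct, TensorProduct.curry_apply, LinearMap.comp_apply,
    LinearEquiv.coe_coe, TensorProduct.assoc_tmul, LinearMap.lTensor_tmul]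
  induction E.ψ (c ⊗ₜ a) with
  | zero => simp
  | tmul x y => simp
  | add x y hx hy => simp only [TensorProduct.tmul_add, map_add, hx, hy]

theorem tensorAct_one (h1 : ∀ m, act m 1 = m) (x : M ⊗[k] C) :
    E.tensorAct act x 1 = x := by
  induction x with
  | zero => simp
  | tmul m c => simp [tensorAct_tmul, E.map_one, h1]
  | add x y hx hy => simp only [map_add, LinearMap.add_apply, hx, hy]

theorem tensorAct_mul (hmul : ∀ m a b, act m (a * b) = act (act m a) b) (x : M ⊗[k] C)
    (a b : A) : E.tensorAct act x (a * b) = E.tensorAct act (E.tensorAct act x a) b := by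
  induction x with
  | zero => simp
  | add x y hx hy => simp only [map_add, LinearMap.add_apply, hx, hy]
  | tmul m c =>
    rw [tensorAct_tmul, tensorAct_tmul, E.map_mul]
    induction E.ψ (c ⊗ₜ a) with
    | zero => simp
    | add x y hx hy =>
      simp only [TensorProduct.add_tmul, map_add, LinearMap.add_apply, hx, hy]
    | tmul a' c' =>
      simp only [TensorProduct.assoc_tmul, LinearMap.lTensor_tmul, LinearMap.rTensor_tmul,
        tensorAct_tmul]
      induction E.ψ (c' ⊗ₜ b) with
      | zero => simp
      | add x y hx hy => simp only [TensorProduct.tmul_add, map_add, hx, hy]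
      | tmul a'' c'' => simp [hmul]

/-- The coaction `m ⊗ c ↦ m ⊗ c₍₁₎ ⊗ c₍₂₎` on `M ⊗ C`. -/
noncomputable def tensorCoact (k : Type uk) (C : Type uC) [CommRing k] [AddCommGroup C]
    [Module k C] [Coalgebra k C] (M : Type w) [AddCommGroup M] [Module k M] :
    M ⊗[k] C →ₗ[k] (M ⊗[k] C) ⊗[k] C :=
  (TensorProduct.assoc k M C C).symm.toLinearMap ∘ₗ
    (Coalgebra.comul (R := k) (A := C)).lTensor M

theorem tensorCoact_tmul (m : M) (c : C) :
    tensorCoact k C M (m ⊗ₜ c) =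
      (TensorProduct.mk k M C m).rTensor C (Coalgebra.comul (R := k) c) := by
  simp only [tensorCoact, LinearMap.comp_apply, LinearMap.lTensor_tmul, LinearEquiv.coe_coe]
  induction Coalgebra.comul (R := k) c with
  | zero => simp
  | tmul x y => simp
  | add x y hx hy => simp only [TensorProduct.tmul_add, map_add, hx, hy]

theorem tensorCoact_coassoc (x : M ⊗[k] C) :
    TensorProduct.assoc k (M ⊗[k] C) C C ((tensorCoact k C M).rTensor C (tensorCoact k C M x)) =
      (Coalgebra.comul (R := k) (A := C)).lTensor (M ⊗[k] C) (tensorCoact k C M x) := by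
  induction x with
  | zero => simp
  | add x y hx hy => simp only [map_add, hx, hy]
  | tmul m c =>
    have h := congrArg ((TensorProduct.mk k M C m).rTensor (C ⊗[k] C))
      (Coalgebra.coassoc_apply (R := k) c)
    rw [tensorCoact_tmul]
    have e1 : ∀ t : C ⊗[k] C, (Coalgebra.comul (R := k) (A := C)).lTensor (M ⊗[k] C)
        ((TensorProduct.mk k M C m).rTensor C t) =
        (TensorProduct.mk k M C m).rTensor (C ⊗[k] C)
          ((Coalgebra.comul (R := k) (A := C)).lTensor C t) := fun t => by
      induction t with
      | zero => simp
      | add x y hx hy => simp only [map_add, hx, hy]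
      | tmul x y => simp
    have e2 : ∀ t : C ⊗[k] C, TensorProduct.assoc k (M ⊗[k] C) C C
        ((tensorCoact k C M).rTensor C ((TensorProduct.mk k M C m).rTensor C t)) =
        (TensorProduct.mk k M C m).rTensor (C ⊗[k] C) (TensorProduct.assoc k C C C
          ((Coalgebra.comul (R := k) (A := C)).rTensor C t)) := fun t => by
      induction t with
      | zero => simp
      | add x y hx hy => simp only [map_add, hx, hy]
      | tmul x y =>
        simp only [LinearMap.rTensor_tmul, TensorProduct.mk_apply, tensorCoact_tmul]
        induction Coalgebra.comul (R := k) x with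
        | zero => simp
        | add x y hx hy => simp only [map_add, TensorProduct.add_tmul, hx, hy]
        | tmul x y => simp
    rw [e1, e2, h]

theorem tensorCoact_counit (x : M ⊗[k] C) :
    TensorProduct.rid k (M ⊗[k] C) ((Coalgebra.counit (R := k) (A := C)).lTensor (M ⊗[k] C)
      (tensorCoact k C M x)) = x := by
  induction x with
  | zero => simp
  | add x y hx hy => simp only [map_add, hx, hy]
  | tmul m c =>
    rw [tensorCoact_tmul]
    have e : ∀ t : C ⊗[k] C, TensorProduct.rid k (M ⊗[k] C)
        ((Coalgebra.counit (R := k) (A := C)).lTensor (M ⊗[k] C)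
          ((TensorProduct.mk k M C m).rTensor C t)) =
        m ⊗ₜ TensorProduct.rid k C ((Coalgebra.counit (R := k) (A := C)).lTensor C t) :=
      fun t => by
      induction t with
      | zero => simp
      | add x y hx hy => simp only [map_add, TensorProduct.tmul_add, hx, hy]
      | tmul x y => simp
    rw [e, Coalgebra.lTensor_counit_comul]
    simp

theorem tensorCoact_tensorAct (x : M ⊗[k] C) (a : A) :
    tensorCoact k C M (E.tensorAct act x a) =
      E.tensorAct (E.tensorAct act) (tensorCoact k C M x) a := by
  induction x with
  | zero => simp
  | add x y hx hy => simp only [map_add, LinearMap.add_apply, hx, hy]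
  | tmul m c =>
    rw [tensorAct_tmul, tensorCoact_tmul]
    have e1 : ∀ t : A ⊗[k] C, tensorCoact k C M ((act m).rTensor C t) =
        (TensorProduct.assoc k M C C).symm ((act m).rTensor (C ⊗[k] C)
          ((Coalgebra.comul (R := k) (A := C)).lTensor A t)) := fun t => by
      induction t with
      | zero => simp
      | add x y hx hy => simp only [map_add, hx, hy]
      | tmul x y => simp [tensorCoact]
    rw [e1, E.map_comul]
    induction Coalgebra.comul (R := k) c with
    | zero => simp
    | add x y hx hy =>
      simp only [TensorProduct.add_tmul, map_add, LinearMap.add_apply, hx, hy]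
    | tmul c₁ c₂ =>
      simp only [TensorProduct.assoc_tmul, LinearMap.lTensor_tmul, LinearMap.rTensor_tmul,
        TensorProduct.mk_apply, tensorAct_tmul]
      induction E.ψ (c₂ ⊗ₜ a) with
      | zero => simp
      | add x y hx hy => simp only [TensorProduct.tmul_add, map_add, hx, hy]
      | tmul a' c' =>
        simp only [TensorProduct.assoc_symm_tmul, LinearMap.rTensor_tmul, tensorAct_tmul]
        induction E.ψ (c₁ ⊗ₜ a') with
        | zero => simp
        | add x y hx hy => simp only [TensorProduct.add_tmul, map_add, hx, hy]
        | tmul a'' c'' => simp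

/-- The entwined module `M ⊗ C` of a right `A`-module `M`, with action
`(m ⊗ c) a = m a_ψ ⊗ c^ψ` and coaction `m ⊗ c ↦ m ⊗ c₍₁₎ ⊗ c₍₂₎`. -/
noncomputable def tensorObj (h1 : ∀ m, act m 1 = m)
    (hmul : ∀ m a b, act m (a * b) = act (act m a) b) :
    EntwinedModule.{uk, uA, uC, max w uC} E where
  carrier := M ⊗[k] C
  act := E.tensorAct act
  coact := tensorCoact k C M
  act_one := E.tensorAct_one act h1
  act_mul := E.tensorAct_mul act hmul
  coact_coassoc := tensorCoact_coassoc
  coact_counit := tensorCoact_counit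
  coact_act := E.tensorCoact_tensorAct act

end tensor

/-- The right `A`-action on `Hom_k(A, V)`: `(f a)(b) = f(ab)`. -/
noncomputable def homAct (k : Type uk) (A : Type uA) [CommRing k] [Ring A] [Algebra k A]
    (V : Type w) [AddCommGroup V] [Module k V] :
    (A →ₗ[k] V) →ₗ[k] A →ₗ[k] (A →ₗ[k] V) :=
  LinearMap.mk₂ k (fun f a => f ∘ₗ LinearMap.mulLeft k a)
    (fun _ _ _ => rfl) (fun _ _ _ => rfl)
    (fun f a b => by ext; simp [add_mul]) (fun r f a => by ext; simp)

/-- The entwined module `Hom_k(A, V) ⊗ C`. -/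
noncomputable def homTensor (V : Type w) [AddCommGroup V] [Module k V] :
    EntwinedModule.{uk, uA, uC, max w uA uC} E :=
  E.tensorObj (homAct k A V) (fun f => by ext b; simp [homAct])
    (fun f a b => by ext x; simp [homAct])

end EntwiningStructure

namespace EntwinedModule

variable {E : EntwiningStructure k A C}

theorem tensorAct_rTensor {M N : Type*} [AddCommGroup M] [Module k M] [AddCommGroup N]
    [Module k N] (actM : M →ₗ[k] A →ₗ[k] M) (actN : N →ₗ[k] A →ₗ[k] N) (f : M →ₗ[k] N)
    (hf : ∀ m a, f (actM m a) = actN (f m) a) (x : M ⊗[k] C) (a : A) :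
    f.rTensor C (E.tensorAct actM x a) = E.tensorAct actN (f.rTensor C x) a := by
  induction x with
  | zero => simp
  | add x y hx hy => simp only [map_add, LinearMap.add_apply, hx, hy]
  | tmul m c =>
    simp only [LinearMap.rTensor_tmul, EntwiningStructure.tensorAct_tmul]
    rw [← LinearMap.comp_apply, ← LinearMap.rTensor_comp]
    congr 2
    ext a
    simp [hf]

/-- The action `(m, n) a = (m a, n a)`. -/
noncomputable def prodAct (M N : EntwinedModule.{uk, uA, uC, w} E) :
    (M.carrier × N.carrier) →ₗ[k] A →ₗ[k] (M.carrier × N.carrier) :=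
  LinearMap.mk₂ k (fun x a => (M.act x.1 a, N.act x.2 a))
    (fun x y a => by simp) (fun r x a => by simp)
    (fun x a b => by simp) (fun r x a => by simp)

/-- The coaction on `M × N` which extends those of `M` and `N`. -/
noncomputable def prodCoact (M N : EntwinedModule.{uk, uA, uC, w} E) :
    (M.carrier × N.carrier) →ₗ[k] (M.carrier × N.carrier) ⊗[k] C :=
  LinearMap.coprod ((LinearMap.inl k M.carrier N.carrier).rTensor C ∘ₗ M.coact)
    ((LinearMap.inr k M.carrier N.carrier).rTensor C ∘ₗ N.coact)

theorem prodCoact_apply (M N : EntwinedModule.{uk, uA, uC, w} E)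
    (x : M.carrier × N.carrier) : prodCoact M N x =
      (LinearMap.inl k M.carrier N.carrier).rTensor C (M.coact x.1) +
      (LinearMap.inr k M.carrier N.carrier).rTensor C (N.coact x.2) := by
  simp [prodCoact]

/-- If `f` intertwines `ρ` and `ρ'`, coassociativity is transported along `f`. -/
theorem coassoc_transport {M N : Type*} [AddCommGroup M] [Module k M] [AddCommGroup N]
    [Module k N] (ρ : M →ₗ[k] M ⊗[k] C) (ρ' : N →ₗ[k] N ⊗[k] C) (f : M →ₗ[k] N)
    (hf : ρ' ∘ₗ f = f.rTensor C ∘ₗ ρ) (m : M)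
    (hm : TensorProduct.assoc k M C C (ρ.rTensor C (ρ m)) =
      (Coalgebra.comul (R := k) (A := C)).lTensor M (ρ m)) :
    TensorProduct.assoc k N C C (ρ'.rTensor C (f.rTensor C (ρ m))) =
      (Coalgebra.comul (R := k) (A := C)).lTensor N (f.rTensor C (ρ m)) := by
  have e1 : ∀ t : (M ⊗[k] C) ⊗[k] C, TensorProduct.assoc k N C C
      ((f.rTensor C).rTensor C t) =
      f.rTensor (C ⊗[k] C) (TensorProduct.assoc k M C C t) := fun t => by
    rw [← LinearEquiv.coe_coe, ← LinearEquiv.coe_coe, ← LinearMap.comp_apply,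
      ← LinearMap.comp_apply]
    congr 1
    ext; simp
  have e2 : ∀ t : M ⊗[k] C, (Coalgebra.comul (R := k) (A := C)).lTensor N (f.rTensor C t) =
      f.rTensor (C ⊗[k] C) ((Coalgebra.comul (R := k) (A := C)).lTensor M t) := fun t => by
    rw [← LinearMap.comp_apply, ← LinearMap.comp_apply, LinearMap.lTensor_comp_rTensor,
      LinearMap.rTensor_comp_lTensor]
  rw [← LinearMap.comp_apply, ← LinearMap.rTensor_comp, hf, LinearMap.rTensor_comp,
    LinearMap.comp_apply, e1, hm, e2]

theorem counit_transport {M N : Type*} [AddCommGroup M] [Module k M] [AddCommGroup N]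
    [Module k N] (f : M →ₗ[k] N) (t : M ⊗[k] C) :
    TensorProduct.rid k N ((Coalgebra.counit (R := k) (A := C)).lTensor N (f.rTensor C t)) =
      f (TensorProduct.rid k M ((Coalgebra.counit (R := k) (A := C)).lTensor M t)) := by
  induction t with
  | zero => simp
  | add x y hx hy => simp only [map_add, hx, hy]
  | tmul x y => simp

/-- The direct sum `M ⊕ N` of entwined modules, on the `k`-module `M × N`. -/
noncomputable def directSum (M N : EntwinedModule.{uk, uA, uC, w} E) :
    EntwinedModule.{uk, uA, uC, w} E where
  carrier := M.carrier × N.carrier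
  act := prodAct M N
  coact := prodCoact M N
  act_one x := by simp [prodAct, M.act_one, N.act_one]
  act_mul x a b := by simp [prodAct, M.act_mul, N.act_mul]
  coact_coassoc x := by
    simp only [prodCoact_apply, map_add]
    rw [coassoc_transport M.coact _ _ (by ext; simp [prodCoact]) _ (M.coact_coassoc _),
      coassoc_transport N.coact _ _ (by ext; simp [prodCoact]) _ (N.coact_coassoc _)]
  coact_counit x := by
    simp only [prodCoact_apply, map_add, counit_transport, M.coact_counit, N.coact_counit]
    simp
  coact_act x a := by
    simp only [prodCoact_apply, map_add, LinearMap.add_apply]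
    rw [← tensorAct_rTensor M.act (prodAct M N) _ (by intros; simp [prodAct]),
      ← tensorAct_rTensor N.act (prodAct M N) _ (by intros; simp [prodAct]),
      ← M.coact_act, ← N.coact_act]
    rfl

/-- `Q` is isomorphic to a direct summand of `X`: there is an entwined module `P` with
`X ≅ Q ⊕ P`. -/
def IsIsoToDirectSummand (Q X : EntwinedModule.{uk, uA, uC, w} E) : Prop :=
  ∃ P : EntwinedModule.{uk, uA, uC, w} E, Nonempty (X ≅ directSum Q P)

end EntwinedModule

end

/-! The construction `V ↦ Hom_k(A, V) ⊗ C` is right adjoint to the forgetful functor from entwined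
modules to vector spaces: a linear `g : M → V` corresponds to the morphism `m ↦ g(m₍₀₎ -) ⊗ m₍₁₎`,
and `g` is recovered by applying `ε` and evaluating at `1`. The proof needs only naturality in `M`
(`comp_cofreeLift`) and that every morphism arises this way (`cofreeLift_cofreeProj`).

Over a field, monomorphisms are injective (`injective_of_mono`), hence split linearly. Extending a
morphism into a cofree object thus becomes extending a linear map, so cofree objects are injective.
Conversely, the unit embeds `Q` into `Hom_k(A, Q) ⊗ C`, and this embedding splits when `Q` is
injective. Finally, retracts are the same as direct summands, a complement being the kernel of the
retraction. -/

section

variable {k : Type uk} {A : Type uA} {C : Type uC}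

namespace EntwinedModule

section CommRing

variable [CommRing k] [Ring A] [Algebra k A] [AddCommGroup C] [Module k C] [Coalgebra k C]
  {E : EntwiningStructure k A C}

@[simp]
theorem comp_toLinearMap {M N P : EntwinedModule.{uk, uA, uC, w} E} (f : M ⟶ N) (g : N ⟶ P) :
    Hom.toLinearMap (f ≫ g) = Hom.toLinearMap g ∘ₗ Hom.toLinearMap f := rfl

theorem hom_ext {M N : EntwinedModule.{uk, uA, uC, w} E} {f g : M ⟶ N}
    (h : Hom.toLinearMap f = Hom.toLinearMap g) : f = g :=
  Hom.ext h

theorem mono_of_injective {M N : EntwinedModule.{uk, uA, uC, w} E} (f : M ⟶ N)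
    (hf : Function.Injective (Hom.toLinearMap f)) : Mono f where
  right_cancellation _ _ e := hom_ext <| LinearMap.ext fun x =>
    hf (LinearMap.congr_fun (congrArg Hom.toLinearMap e) x)

/-- A bijective morphism of entwined modules is an isomorphism. -/
noncomputable def isoOfBijective {M N : EntwinedModule.{uk, uA, uC, w} E} (f : M ⟶ N)
    (hf : Function.Bijective (Hom.toLinearMap f)) : M ≅ N :=
  let e := LinearEquiv.ofBijective (Hom.toLinearMap f) hf
  have hfe : (Hom.toLinearMap f) = e.toLinearMap := rfl
  { hom := f
    inv :=
      { toLinearMap := e.symm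
        map_act := fun n a => by
          obtain ⟨m, rfl⟩ := e.surjective n
          rw [LinearEquiv.coe_coe, LinearEquiv.symm_apply_apply, LinearEquiv.symm_apply_eq]
          exact (Hom.map_act f m a).symm
        map_coact := fun n => by
          obtain ⟨m, rfl⟩ := e.surjective n
          have h : N.coact (e m) = _ := Hom.map_coact f m
          rw [h, ← LinearMap.rTensor_comp_apply, hfe]
          simp }
    hom_inv_id := hom_ext <| LinearMap.ext e.symm_apply_apply
    inv_hom_id := hom_ext <| LinearMap.ext e.apply_symm_apply }

/-! ### Cofree entwined modules and their universal property -/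

section CofreeLift

variable {M : EntwinedModule.{uk, uA, uC, max w uA uC} E}
  {V : Type (max w uA uC)} [AddCommGroup V] [Module k V]

theorem tensorCoact_rTensor {M N : Type*} [AddCommGroup M] [Module k M] [AddCommGroup N]
    [Module k N] (f : M →ₗ[k] N) (x : M ⊗[k] C) :
    EntwiningStructure.tensorCoact k C N (f.rTensor C x) =
      (f.rTensor C).rTensor C (EntwiningStructure.tensorCoact k C M x) := by
  induction x with
  | zero => simp
  | add x y hx hy => simp only [map_add, hx, hy]
  | tmul m c =>
    rw [LinearMap.rTensor_tmul, EntwiningStructure.tensorCoact_tmul,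
      EntwiningStructure.tensorCoact_tmul, ← LinearMap.rTensor_comp_apply]
    rfl

/-- Coassociativity, read as colinearity of the coaction itself. -/
theorem tensorCoact_coact (M : EntwinedModule.{uk, uA, uC, w} E) (m : M.carrier) :
    EntwiningStructure.tensorCoact k C M.carrier (M.coact m) =
      M.coact.rTensor C (M.coact m) := by
  rw [EntwiningStructure.tensorCoact, LinearMap.comp_apply, ← M.coact_coassoc]
  simp

/-- The morphism `m ↦ g(m₍₀₎ -) ⊗ m₍₁₎` to `Hom_k(A, V) ⊗ C` induced by a linear map
`g : M → V`. -/
noncomputable def cofreeLift (g : M.carrier →ₗ[k] V) : M ⟶ E.homTensor V where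
  toLinearMap := (M.act.compr₂ g).rTensor C ∘ₗ M.coact
  map_act m a :=
    (congrArg _ (M.coact_act m a)).trans <|
      tensorAct_rTensor M.act (EntwiningStructure.homAct k A V) (M.act.compr₂ g)
        (fun m a => by ext b; simp [EntwiningStructure.homAct, M.act_mul]) _ _
  map_coact m :=
    (tensorCoact_rTensor (M.act.compr₂ g) (M.coact m)).trans <|
      (congrArg _ (tensorCoact_coact M m)).trans
        (LinearMap.rTensor_comp_apply C _ _ _).symm

theorem cofreeLift_apply (g : M.carrier →ₗ[k] V) (m : M.carrier) :
    Hom.toLinearMap (cofreeLift g) m = (M.act.compr₂ g).rTensor C (M.coact m) := rfl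

theorem comp_cofreeLift {N : EntwinedModule.{uk, uA, uC, max w uA uC} E} (f : N ⟶ M)
    (g : M.carrier →ₗ[k] V) :
    f ≫ cofreeLift g = cofreeLift (g ∘ₗ Hom.toLinearMap f) := by
  refine hom_ext (LinearMap.ext fun n => ?_)
  rw [comp_toLinearMap, LinearMap.comp_apply, cofreeLift_apply, cofreeLift_apply,
    Hom.map_coact, ← LinearMap.comp_apply, ← LinearMap.rTensor_comp]
  congr 2
  ext n a
  simp [Hom.map_act]

/-- The map `M ⊗ C → M`, `m ⊗ c ↦ ε(c) m`. -/
noncomputable def tensorCounit (k : Type uk) (C : Type uC) [CommRing k] [AddCommGroup C]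
    [Module k C] [Coalgebra k C] (M : Type*) [AddCommGroup M] [Module k M] :
    M ⊗[k] C →ₗ[k] M :=
  (TensorProduct.rid k M).toLinearMap ∘ₗ (Coalgebra.counit (R := k) (A := C)).lTensor M

theorem tensorCounit_tmul {M : Type*} [AddCommGroup M] [Module k M] (m : M) (c : C) :
    tensorCounit k C M (m ⊗ₜ c) = Coalgebra.counit (R := k) c • m := by
  simp [tensorCounit]

theorem tensorCounit_rTensor {M N : Type*} [AddCommGroup M] [Module k M] [AddCommGroup N]
    [Module k N] (f : M →ₗ[k] N) (x : M ⊗[k] C) :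
    tensorCounit k C N (f.rTensor C x) = f (tensorCounit k C M x) :=
  counit_transport f x

/-- This is the axiom `ε(c^ψ) a_ψ = ε(c) a` pushed forward along `a ↦ m a`. -/
theorem tensorCounit_tensorAct {M : Type*} [AddCommGroup M] [Module k M]
    (act : M →ₗ[k] A →ₗ[k] M) (x : M ⊗[k] C) (a : A) :
    tensorCounit k C M (E.tensorAct act x a) = act (tensorCounit k C M x) a := by
  induction x with
  | zero => simp
  | add x y hx hy => simp only [map_add, LinearMap.add_apply, hx, hy]
  | tmul m c =>
    have h : tensorCounit k C A (E.ψ (c ⊗ₜ a)) = _ := E.map_counit c a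
    rw [EntwiningStructure.tensorAct_tmul, tensorCounit_rTensor, h, tensorCounit_tmul]
    simp

/-- The left counit law of `C`. It lets a colinear map into `M ⊗ C` be rebuilt from its composite
with `tensorCounit`. -/
theorem rTensor_tensorCounit_tensorCoact {M : Type*} [AddCommGroup M] [Module k M]
    (x : M ⊗[k] C) :
    (tensorCounit k C M).rTensor C (EntwiningStructure.tensorCoact k C M x) = x := by
  induction x with
  | zero => simp
  | add x y hx hy => simp only [map_add, hx, hy]
  | tmul m c =>
    have h : tensorCounit k C M ∘ₗ TensorProduct.mk k M C m =
        LinearMap.toSpanSingleton k M m ∘ₗ Coalgebra.counit (R := k) (A := C) :=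
      LinearMap.ext fun c => by simp [tensorCounit_tmul]
    rw [EntwiningStructure.tensorCoact_tmul, ← LinearMap.comp_apply, ← LinearMap.rTensor_comp,
      h, LinearMap.rTensor_comp, LinearMap.comp_apply, Coalgebra.rTensor_counit_comul]
    simp

/-- The linear map `M → V` underlying a morphism `M → Hom_k(A, V) ⊗ C`. -/
noncomputable def cofreeProj (f : M ⟶ E.homTensor V) : M.carrier →ₗ[k] V :=
  LinearMap.applyₗ (1 : A) ∘ₗ tensorCounit k C (A →ₗ[k] V) ∘ₗ
    (show M.carrier →ₗ[k] (A →ₗ[k] V) ⊗[k] C from Hom.toLinearMap f)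

/-- Linearity over `A` recovers the functional `(id ⊗ ε)(f m)` from its values at `1`, since `(φ
a)(1) = φ(a)`; colinearity then recovers `f m` from these functionals. -/
theorem cofreeLift_cofreeProj (f : M ⟶ E.homTensor V) : cofreeLift (cofreeProj f) = f := by
  let f' : M.carrier →ₗ[k] (A →ₗ[k] V) ⊗[k] C := Hom.toLinearMap f
  have hact (m a) : f' (M.act m a) = E.tensorAct (EntwiningStructure.homAct k A V) (f' m) a :=
    Hom.map_act f m a
  have hcoact (m) : EntwiningStructure.tensorCoact k C (A →ₗ[k] V) (f' m) =
      f'.rTensor C (M.coact m) := Hom.map_coact f m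
  have hproj : cofreeProj f = LinearMap.applyₗ (1 : A) ∘ₗ tensorCounit k C (A →ₗ[k] V) ∘ₗ f' :=
    rfl
  have h : M.act.compr₂ (cofreeProj f) = tensorCounit k C (A →ₗ[k] V) ∘ₗ f' := by
    ext m a
    simp only [hproj, LinearMap.compr₂_apply, LinearMap.comp_apply,
      LinearMap.applyₗ_apply_apply, hact, tensorCounit_tensorAct]
    simp [EntwiningStructure.homAct]
  refine hom_ext (LinearMap.ext fun m => ?_)
  rw [cofreeLift_apply, h, LinearMap.rTensor_comp_apply, ← hcoact,
    rTensor_tensorCounit_tensorCoact]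
  rfl

theorem cofreeLift_id_injective (M : EntwinedModule.{uk, uA, uC, max w uA uC} E) :
    Function.Injective
      (Hom.toLinearMap (cofreeLift (LinearMap.id : M.carrier →ₗ[k] M.carrier))) := by
  refine Function.LeftInverse.injective
    -- The left inverse is the counit of the adjunction: it sends `m₍₀₎(-) ⊗ m₍₁₎` to `ε(m₍₁₎) m₍₀₎
    -- 1 = m`.
    (g := fun x => (tensorCounit k C (A →ₗ[k] M.carrier) x) 1) fun m => ?_
  have h : tensorCounit k C M.carrier (M.coact m) = m := M.coact_counit m
  dsimp only
  rw [cofreeLift_apply, tensorCounit_rTensor, h]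
  simp [M.act_one]

end CofreeLift

end CommRing

section Field

variable [Field k] [Ring A] [Algebra k A] [AddCommGroup C] [Module k C] [Coalgebra k C]
  {E : EntwiningStructure k A C}

/-! ### Kernels over a field, and injectivity of monomorphisms -/

section Kernel

variable {M N : EntwinedModule.{uk, uA, uC, w} E} (f : M ⟶ N)

/-- The coaction on the kernel of a morphism. -/
noncomputable def kerCoact :
    LinearMap.ker (Hom.toLinearMap f) →ₗ[k] LinearMap.ker (Hom.toLinearMap f) ⊗[k] C :=
  -- An arbitrary linear retraction of `M` onto the kernel brings the coaction back into `ker ⊗ C`.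
  ((LinearMap.ker (Hom.toLinearMap f)).subtype.exists_leftInverse_of_injective
    (Submodule.ker_subtype _)).choose.rTensor C ∘ₗ M.coact ∘ₗ
      (LinearMap.ker (Hom.toLinearMap f)).subtype

/-- By flatness of `C`, `ker ⊗ C` is the kernel of `f ⊗ C`, so the coaction of a kernel element
already lies there and the chosen retraction changes nothing. -/
theorem rTensor_subtype_kerCoact (m : LinearMap.ker (Hom.toLinearMap f)) :
    (LinearMap.ker (Hom.toLinearMap f)).subtype.rTensor C (kerCoact f m) = M.coact m := by
  have hex := Module.Flat.rTensor_exact C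
    (LinearMap.exact_subtype_ker_map (Hom.toLinearMap f))
  obtain ⟨y, hy⟩ := (hex (M.coact m)).1 (by
    rw [← Hom.map_coact f, m.2, map_zero])
  have hr := ((LinearMap.ker (Hom.toLinearMap f)).subtype.exists_leftInverse_of_injective
    (Submodule.ker_subtype _)).choose_spec
  rw [kerCoact, LinearMap.comp_apply, LinearMap.comp_apply, Submodule.subtype_apply, ← hy,
    ← LinearMap.comp_apply (LinearMap.rTensor C (Exists.choose _)), ← LinearMap.rTensor_comp, hr,
    LinearMap.rTensor_id, LinearMap.id_apply]

/-- The action on the kernel of a morphism. -/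
noncomputable def kerAct :
    LinearMap.ker (Hom.toLinearMap f) →ₗ[k] A →ₗ[k] LinearMap.ker (Hom.toLinearMap f) :=
  LinearMap.mk₂ k (fun m a => ⟨M.act m a, by
      rw [LinearMap.mem_ker, Hom.map_act, m.2, map_zero, LinearMap.zero_apply]⟩)
    (fun _ _ _ => by ext; simp) (fun _ _ _ => by ext; simp)
    (fun _ _ _ => by ext; simp) (fun _ _ _ => by ext; simp)

/-- The kernel of a morphism of entwined modules over a field. -/
noncomputable def ker : EntwinedModule.{uk, uA, uC, w} E where
  carrier := LinearMap.ker (Hom.toLinearMap f)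
  act := kerAct f
  coact := kerCoact f
  act_one m := Subtype.ext (M.act_one m)
  act_mul m a b := Subtype.ext (M.act_mul m a b)
  coact_coassoc m := by
    set i := (LinearMap.ker (Hom.toLinearMap f)).subtype with hi
    have hρ : i.rTensor C ∘ₗ kerCoact f = M.coact ∘ₗ i :=
      LinearMap.ext (rTensor_subtype_kerCoact f)
    -- By flatness the identity may be checked after embedding into `M ⊗ (C ⊗ C)`, where it is
    -- coassociativity of `M`.
    apply Module.Flat.rTensor_preserves_injective_linearMap (M := C ⊗[k] C) i
      Subtype.val_injective
    have e1 : ∀ t, i.rTensor (C ⊗[k] C) (TensorProduct.assoc k _ C C t) =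
        TensorProduct.assoc k _ C C ((i.rTensor C).rTensor C t) := fun t => by
      rw [← LinearEquiv.coe_coe, ← LinearEquiv.coe_coe, ← LinearMap.comp_apply,
        ← LinearMap.comp_apply]
      congr 1
      ext; simp
    have e2 : ∀ t, i.rTensor (C ⊗[k] C)
        ((Coalgebra.comul (R := k) (A := C)).lTensor _ t) =
        (Coalgebra.comul (R := k) (A := C)).lTensor M.carrier (i.rTensor C t) := fun t => by
      rw [← LinearMap.comp_apply, ← LinearMap.comp_apply, LinearMap.lTensor_comp_rTensor,
        LinearMap.rTensor_comp_lTensor]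
    rw [e1, e2, ← LinearMap.comp_apply (LinearMap.rTensor C (i.rTensor C)),
      ← LinearMap.rTensor_comp, hρ, LinearMap.rTensor_comp, LinearMap.comp_apply,
      rTensor_subtype_kerCoact, M.coact_coassoc]
  coact_counit m := by
    apply Subtype.val_injective
    rw [← Submodule.subtype_apply, ← counit_transport, rTensor_subtype_kerCoact,
      M.coact_counit]
  coact_act m a := by
    apply Module.Flat.rTensor_preserves_injective_linearMap (M := C)
      (LinearMap.ker (Hom.toLinearMap f)).subtype Subtype.val_injective
    rw [rTensor_subtype_kerCoact, tensorAct_rTensor (kerAct f) M.act _ (fun _ _ => rfl),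
      rTensor_subtype_kerCoact]
    exact M.coact_act m a

/-- The inclusion of the kernel. -/
noncomputable def kerι : ker f ⟶ M where
  toLinearMap := (LinearMap.ker (Hom.toLinearMap f)).subtype
  map_act _ _ := rfl
  map_coact m := (rTensor_subtype_kerCoact f m).symm

theorem kerι_apply (m : LinearMap.ker (Hom.toLinearMap f)) :
    Hom.toLinearMap (kerι f) m = m.1 := rfl

/-- The zero morphism. -/
noncomputable def zeroHom (M N : EntwinedModule.{uk, uA, uC, w} E) : M ⟶ N where
  toLinearMap := 0
  map_act := by simp
  map_coact := by simp

/-- The kernel inclusion and the zero morphism agree after composing with `f`, hence are equal. -/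
theorem injective_of_mono [Mono f] : Function.Injective (Hom.toLinearMap f) := by
  refine (injective_iff_map_eq_zero _).2 fun m hm => ?_
  have h : kerι f = zeroHom (ker f) M := by
    rw [← cancel_mono f]
    refine hom_ext (LinearMap.ext fun x => ?_)
    exact x.2.trans (map_zero (Hom.toLinearMap f)).symm
  exact LinearMap.congr_fun (congrArg Hom.toLinearMap h) ⟨m, hm⟩

end Kernel

/-! ### Injectivity of cofree objects -/

theorem injective_homTensor (V : Type (max w uA uC)) [AddCommGroup V] [Module k V] :
    Injective (E.homTensor V : EntwinedModule.{uk, uA, uC, max w uA uC} E) where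
  factors {X Y} f i _ := by
    -- The retraction `r` need only be `k`-linear: the cofree lift of `cofreeProj f ∘ r` is
    -- automatically a morphism.
    obtain ⟨r, hr⟩ := (Hom.toLinearMap i).exists_leftInverse_of_injective
      (LinearMap.ker_eq_bot.2 (injective_of_mono i))
    refine ⟨cofreeLift (cofreeProj f ∘ₗ r), ?_⟩
    rw [comp_cofreeLift, LinearMap.comp_assoc, hr, LinearMap.comp_id, cofreeLift_cofreeProj]

/-! ### Direct summands as retracts -/

/-- The inclusion of the first summand. -/
noncomputable def directSumInl (Q P : EntwinedModule.{uk, uA, uC, w} E) :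
    Q ⟶ directSum Q P where
  toLinearMap := LinearMap.inl k Q.carrier P.carrier
  map_act q a := Prod.ext rfl (LinearMap.map_zero₂ P.act a).symm
  map_coact q := by
    have h : prodCoact Q P (q, 0) =
        (LinearMap.inl k Q.carrier P.carrier).rTensor C (Q.coact q) := by
      rw [prodCoact_apply, map_zero, map_zero, add_zero]
    exact h

/-- The morphism from a direct sum with given components. -/
noncomputable def directSumDesc {Q P X : EntwinedModule.{uk, uA, uC, w} E} (f : Q ⟶ X)
    (g : P ⟶ X) : directSum Q P ⟶ X where
  toLinearMap := (Hom.toLinearMap f).coprod (Hom.toLinearMap g)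
  map_act x a := by
    have h : Hom.toLinearMap f (Q.act x.1 a) + Hom.toLinearMap g (P.act x.2 a) =
        X.act (Hom.toLinearMap f x.1 + Hom.toLinearMap g x.2) a := by
      rw [Hom.map_act, Hom.map_act, map_add, LinearMap.add_apply]
    exact h
  map_coact x := by
    have h (x : Q.carrier × P.carrier) :
        X.coact (Hom.toLinearMap f x.1 + Hom.toLinearMap g x.2) =
        ((Hom.toLinearMap f).coprod (Hom.toLinearMap g)).rTensor C (prodCoact Q P x) := by
      rw [prodCoact_apply, map_add, map_add, ← LinearMap.rTensor_comp_apply,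
        ← LinearMap.rTensor_comp_apply, LinearMap.coprod_inl, LinearMap.coprod_inr,
        Hom.map_coact, Hom.map_coact]
    exact h x

theorem directSumDesc_apply {Q P X : EntwinedModule.{uk, uA, uC, w} E} (f : Q ⟶ X)
    (g : P ⟶ X) (q : Q.carrier) (p : P.carrier) :
    Hom.toLinearMap (directSumDesc f g) (q, p) = Hom.toLinearMap f q + Hom.toLinearMap g p :=
  rfl

theorem isIsoToDirectSummand_iff_retract {Q X : EntwinedModule.{uk, uA, uC, w} E} :
    Q.IsIsoToDirectSummand X ↔ Nonempty (Retract Q X) := by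
  constructor
  · rintro ⟨P, ⟨e⟩⟩
    refine ⟨⟨directSumInl Q P ≫ e.inv, e.hom ≫ directSumDesc (𝟙 Q) (zeroHom P Q), ?_⟩⟩
    rw [Category.assoc, e.inv_hom_id_assoc]
    exact hom_ext (LinearMap.coprod_inl _ _)
  · rintro ⟨i, r, h⟩
    have hri (q : Q.carrier) : Hom.toLinearMap r (Hom.toLinearMap i q) = q :=
      LinearMap.congr_fun (congrArg Hom.toLinearMap h) q
    -- The idempotent splitting `x = i(r x) + (x - i(r x))`, with second term in `ker r`.
    refine ⟨ker r, ⟨(isoOfBijective (directSumDesc i (kerι r)) ⟨?_, fun x => ?_⟩).symm⟩⟩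
    · refine (injective_iff_map_eq_zero _).2 ?_
      rintro ⟨q, p⟩ hqp
      have hqp' : Hom.toLinearMap i q + p.1 = 0 := hqp
      have hq : q = 0 := by
        have := congrArg (Hom.toLinearMap r) hqp'
        rwa [map_add, hri, p.2, add_zero, map_zero] at this
      subst hq
      rw [map_zero, zero_add] at hqp'
      exact Prod.ext rfl (Subtype.ext hqp')
    · refine ⟨(Hom.toLinearMap r x, ⟨x - Hom.toLinearMap i (Hom.toLinearMap r x), ?_⟩), ?_⟩
      · rw [LinearMap.mem_ker, map_sub, hri, sub_self]
      · exact (directSumDesc_apply i (kerι r) _ _).trans (add_sub_cancel _ _)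

end Field

end EntwinedModule

end

/-! ### Characterisation of injective entwined modules -/

theorem corollary4p5 {k : Type uk} {A : Type uA} {C : Type uC} [Field k]
    [Ring A] [Algebra k A] [AddCommGroup C] [Module k C] [Coalgebra k C]
    (E : EntwiningStructure k A C) (Q : EntwinedModule.{uk, uA, uC, max w uA uC} E) :
    Injective Q ↔
      ∃ (V : Type (max w uA uC)) (_ : AddCommGroup V) (_ : Module k V),
        Q.IsIsoToDirectSummand (E.homTensor V) := by
  constructor
  · intro _
    have := EntwinedModule.mono_of_injective _ (EntwinedModule.cofreeLift_id_injective Q)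
    -- The choice `V = Q` is possible because the universe of `Q` absorbs those of `A` and `C`, so
    -- `Hom_k(A, Q) ⊗ C` lies in the same category.
    exact ⟨Q.carrier, inferInstance, inferInstance,
      EntwinedModule.isIsoToDirectSummand_iff_retract.2
        ⟨⟨EntwinedModule.cofreeLift LinearMap.id,
          Injective.factorThru (𝟙 Q) (EntwinedModule.cofreeLift LinearMap.id),
          Injective.comp_factorThru _ _⟩⟩⟩
  · rintro ⟨V, _, _, h⟩
    obtain ⟨r⟩ := EntwinedModule.isIsoToDirectSummand_iff_retract.1 h
    have := EntwinedModule.injective_homTensor (E := E) V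
    -- A retract of an injective object is injective: extend into the large object, then retract.
    refine ⟨fun g f _ => ⟨Injective.factorThru (g ≫ r.i) f ≫ r.r, ?_⟩⟩
    rw [← Category.assoc, Injective.comp_factorThru, Category.assoc, r.retract, Category.comp_id]
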